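/- Let $q=2^n$ with $n\ge 1$, let $T=\mathrm{Sp}(4,q)$ and let $\mathrm{PG}(V)$ be the set of the $q^3+q^2+q+1$ one-dimensional subspaces of $V=\mathbb F_q^4$, on which $T$ acts. A transvection is a nonidentity element of $T$ of the form $x\mapsto x+f(x)v$, where $v\in V$ and $f$ is a linear form on $V$ with $f(v)=0$. For an $r$-tuple $\mathcal I=(\rho_1,\dots,\rho_r)$ of permutation representations of $T$ on $\mathrm{PG}(V)$, the twisted permutation code $C(T,\mathcal I)$ is the set of the words $$\alpha(t,\mathcal I)=\bigl((\rho_1(t)\omega)_{\omega\in \mathrm{PG}(V)},\dots,(\rho_r(t)\omega)_{\omega\in \mathrm{PG}(V)}\bigr),\qquad t\in T,$$ of length $r\,|\mathrm{PG}(V)|$ over the alphabet $\mathrm{PG}(V)$. Its minimum distance $\delta(C(T,\mathcal I))$ is the smallest Hamming distance between two distinct codewords. Write $\mathrm{Rep}_r(C(T,\rho))=C(T,(\rho,\dots,\rho))$, with $r$ copies of $\rho$. An automorphism $\sigma$ of $T$ is read as the permutation representation $t\mapsto(\omega\mapsto\sigma(t)\omega)$ of $T$ on $\mathrm{PG}(V)$.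 There is an outer (that is, not inner) automorphism $\tau$ of $T$ such that for every transvection $t\in T$ the element $\tau(t)$ fixes exactly $q+1$ one-dimensional subspaces of $V$. For every such $\tau$ and $\mathcal I=(\iota,\tau)$, where $\iota$ is the identity automorphism of $T$, the code $C(T,\mathcal I)$, of length $2(q^3+q^2+q+1)$, has minimum distance $$\delta(C(T,\mathcal I))=2q^3+q^2,$$ while the repetition lower bound is $$\min_{\rho\in\mathcal I}\delta\bigl(\mathrm{Rep}_2(C(T,\rho))\bigr)=2q^3,$$ so that the difference between $\delta(C(T,\mathcal I))$ and this lower bound is $q^2$. -/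

import Mathlib

open scoped LinearAlgebra.Projectivization

namespace TwistedPermCode

/-- The minimum distance of a code `C` (a set of words with letters in `α` and positions in `ι`):
the smallest Hamming distance between distinct codewords. It is `0` if there are no two distinct
codewords, since `sInf ∅ = 0` in `ℕ`. -/
noncomputable def minDist {ι α : Type*} [Fintype ι] [DecidableEq α] (C : Set (ι → α)) : ℕ :=
  sInf {d : ℕ | ∃ a ∈ C, ∃ b ∈ C, a ≠ b ∧ hammingDist a b = d}

section Codes

variable {T Ω : Type*} [Group T]

/-- The codeword of `t` with respect to an `r`-tuple `I` of permutation representations of `T`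
on `Ω`: the concatenation of the `r` words `(I i t ω)_{ω ∈ Ω}` (the passive forms of the
permutations `I i t`). Its length is `r * |Ω|`, the positions being the pairs `(i, ω)`. -/
def codeword {r : ℕ} (I : Fin r → (T →* Equiv.Perm Ω)) (t : T) : Fin r × Ω → Ω :=
  fun p => I p.1 t p.2

/-- The twisted permutation code `C(T, I)`. -/
def twistedCode {r : ℕ} (I : Fin r → (T →* Equiv.Perm Ω)) : Set (Fin r × Ω → Ω) :=
  Set.range (codeword I)

/-- The `r`-fold repetition code `Rep_r(C(T, ρ))`. -/
def repCode (r : ℕ) (ρ : T →* Equiv.Perm Ω) : Set (Fin r × Ω → Ω) :=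
  twistedCode (fun _ : Fin r => ρ)

/-- The repetition lower bound for `C(T, I)`, where `I = (ρ₁, …, ρᵣ)`:
the minimum over `i` of the minimum distance of `Rep_r(C(T, ρᵢ))`. -/
noncomputable def repBound [Fintype Ω] [DecidableEq Ω] {r : ℕ}
    (I : Fin r → (T →* Equiv.Perm Ω)) : ℕ :=
  ⨅ i : Fin r, minDist (repCode r (I i))

end Codes

section Symplectic

variable (F : Type*) [Field F]

/-- The space `F⁴`, with coordinates indexed by the symplectic basis `e₁, e₂, f₁, f₂`. -/
abbrev V4 : Type _ := Fin 2 ⊕ Fin 2 → F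

/-- The symplectic group `Sp(4, F)`, as a group of `4 × 4` matrices. -/
abbrev Sp4 : Type _ := Matrix.symplecticGroup (Fin 2) F

/-- The permutation representation of `Sp(4, F)` on the set of `1`-dimensional subspaces of `F⁴`,
induced by the multiplication of column vectors by matrices. -/
def proj : Sp4 F →* Equiv.Perm (ℙ F (V4 F)) :=
  MulAction.toPermHom (Sp4 F) (ℙ F (V4 F))

variable {F}

/-- `g` is a transvection: a nonidentity map of the form `x ↦ x + f x • v`, where `f` is a linear
form with `f v = 0`. -/
def IsTransvection (g : Sp4 F) : Prop :=
  g ≠ 1 ∧ ∃ (f : Module.Dual F (V4 F)) (v : V4 F),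
    f v = 0 ∧ Matrix.toLin' (g : Matrix (Fin 2 ⊕ Fin 2) (Fin 2 ⊕ Fin 2) F) =
      LinearMap.transvection f v

/-- The number of `1`-dimensional subspaces of `F⁴` that `g` fixes setwise. -/
noncomputable def numFixed (g : Sp4 F) : ℕ :=
  {x : ℙ F (V4 F) | proj F g x = x}.ncard

/-- `τ` is an outer automorphism of `Sp(4, F)` (one that is not inner), and the image under `τ` of
every transvection fixes exactly `|F| + 1` of the `1`-dimensional subspaces of `F⁴`. -/
def IsTwist (τ : MulAut (Sp4 F)) : Prop :=
  τ ∉ (MulAut.conj : Sp4 F →* MulAut (Sp4 F)).range ∧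
    ∀ g : Sp4 F, IsTransvection g → numFixed (τ g) = Nat.card F + 1

/-- The pair `(ι, τ)`, where `ι` is the identity automorphism of `Sp(4, F)`, read as a pair of
permutation representations of `Sp(4, F)` on the set of `1`-dimensional subspaces of `F⁴`. -/
def pairRep (τ : MulAut (Sp4 F)) : Fin 2 → (Sp4 F →* Equiv.Perm (ℙ F (V4 F))) :=
  ![proj F, (proj F).comp τ.toMonoidHom]

end Symplectic

end TwistedPermCode

/-! The words of s and t agree exactly at the fixed points of s⁻¹t in the two representations, so
the distance is found by maximising fix(t) + fix(τ(t)) over t ≠ 1 (`minDist_twistedCode`). Fixed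
points are the points of eigenspaces. An eigenspace of dimension at least 3 is not totally
isotropic, which forces t to be a transvection (`isTransvection_of_three_le_finrank`), with q²+q+1
fixed points. Any other t ≠ 1 fixes at most 2q+2 points, and exactly q+1 if it is an involution. So
the sum is q²+2q+2 when t or τ(t) is a transvection and never larger (`IsTwist.numFixed_add_le`);
for a repeated representation the maximum is 2(q²+q+1).

A twist exists because in characteristic 2 the invariant bivector ω lies in its own orthogonal in
Λ²V, and ω^⊥/⟨ω⟩ is again a symplectic 4-space. The action on it is an injective endomorphism of the
finite group Sp(4,q), hence an automorphism, and it turns transvections into involutions that are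
not transvections. -/

open scoped LinearAlgebra.Projectivization

namespace TwistedPermCode

/-! ### The exceptional isogeny of Sp(4) in characteristic 2 -/

section GraphMap

variable {F : Type*} [Field F]

/-- The first index of the `i`-th hyperbolic basis bivector `e₁ ∧ e₂, e₁ ∧ f₂, f₁ ∧ f₂, f₁ ∧ e₂`. -/
def bivFst : Fin 2 ⊕ Fin 2 → Fin 2 ⊕ Fin 2 :=
  Sum.elim (fun _ => .inl 0) (fun _ => .inr 0)

/-- The second index of the `i`-th hyperbolic basis bivector
`e₁ ∧ e₂, e₁ ∧ f₂, f₁ ∧ f₂, f₁ ∧ e₂`. -/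
def bivSnd : Fin 2 ⊕ Fin 2 → Fin 2 ⊕ Fin 2 :=
  Sum.elim ![.inl 1, .inr 1] ![.inr 1, .inl 1]

/-- The matrix of `2 × 2` minors giving the action of a symplectic matrix on the subquotient
`ω^⊥ / ⟨ω⟩` of the exterior square. -/
def bivMatrix (M : Matrix (Fin 2 ⊕ Fin 2) (Fin 2 ⊕ Fin 2) F) :
    Matrix (Fin 2 ⊕ Fin 2) (Fin 2 ⊕ Fin 2) F :=
  Matrix.of fun i j => M (bivFst i) (bivFst j) * M (bivSnd i) (bivSnd j) -
    M (bivFst i) (bivSnd j) * M (bivSnd i) (bivFst j)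

/-- The alternating form preserved by the symplectic group. -/
def form (x y : V4 F) : F :=
  x (.inl 0) * y (.inr 0) - x (.inr 0) * y (.inl 0) +
    (x (.inl 1) * y (.inr 1) - x (.inr 1) * y (.inl 1))

lemma mul_J_mul_transpose_apply (M : Matrix (Fin 2 ⊕ Fin 2) (Fin 2 ⊕ Fin 2) F)
    (a b : Fin 2 ⊕ Fin 2) :
    (M * Matrix.J (Fin 2) F * M.transpose) a b = - form (M a) (M b) := by
  simp [Matrix.mul_apply, Matrix.J, Fintype.sum_sum_type, Fin.sum_univ_two, form,
    Matrix.fromBlocks, Matrix.one_apply]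
  ring

lemma J_apply_eq_form (a b : Fin 2 ⊕ Fin 2) :
    Matrix.J (Fin 2) F a b = - form ((1 : Matrix _ _ F) a) ((1 : Matrix _ _ F) b) := by
  rw [← mul_J_mul_transpose_apply]; simp

lemma mem_symplecticGroup_iff_form {M : Matrix (Fin 2 ⊕ Fin 2) (Fin 2 ⊕ Fin 2) F} :
    M ∈ Matrix.symplecticGroup (Fin 2) F ↔
      ∀ a b, form (M a) (M b) = form ((1 : Matrix _ _ F) a) ((1 : Matrix _ _ F) b) := by
  rw [SymplecticGroup.mem_iff, ← Matrix.ext_iff]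
  simp only [mul_J_mul_transpose_apply, J_apply_eq_form, neg_inj]

lemma form_row_biv {M : Matrix (Fin 2 ⊕ Fin 2) (Fin 2 ⊕ Fin 2) F}
    (hM : M ∈ Matrix.symplecticGroup (Fin 2) F) (i : Fin 2 ⊕ Fin 2) :
    form (M (bivFst i)) (M (bivSnd i)) = 0 := by
  rw [mem_symplecticGroup_iff_form.1 hM]
  rcases i with i | i <;> fin_cases i <;> simp [form, bivFst, bivSnd, Matrix.one_apply]

lemma form_col_biv {M : Matrix (Fin 2 ⊕ Fin 2) (Fin 2 ⊕ Fin 2) F}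
    (hM : M ∈ Matrix.symplecticGroup (Fin 2) F) (i : Fin 2 ⊕ Fin 2) :
    form (M.transpose (bivFst i)) (M.transpose (bivSnd i)) = 0 :=
  form_row_biv (SymplecticGroup.transpose_mem hM) i

/-- Cauchy–Binet sums over six bivectors; only e₁∧f₁ and e₂∧f₂ are missing here. Since the rows of M
and the columns of N in question are orthogonal, the two missing terms agree up to a sign in each
factor, so they add up to twice one of them, which is 0. -/
lemma bivMatrix_mul [CharP F 2] {M N : Matrix (Fin 2 ⊕ Fin 2) (Fin 2 ⊕ Fin 2) F}
    (hM : M ∈ Matrix.symplecticGroup (Fin 2) F) (hN : N ∈ Matrix.symplecticGroup (Fin 2) F) :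
    bivMatrix (M * N) = bivMatrix M * bivMatrix N := by
  have h2 : (2 : F) = 0 := CharTwo.two_eq_zero
  ext i j
  have h := form_row_biv hM i
  have h' := form_col_biv hN j
  simp only [form, Matrix.transpose_apply] at h h'
  simp only [bivMatrix, Matrix.mul_apply, Fintype.sum_sum_type, Fin.sum_univ_two, Matrix.of_apply]
  generalize bivFst i = a at *
  generalize bivSnd i = b at *
  generalize bivFst j = c at *
  generalize bivSnd j = d at *
  simp only [bivFst, bivSnd, Sum.elim_inl, Sum.elim_inr, Matrix.cons_val_zero, Matrix.cons_val_one]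
  linear_combination (N (.inl 0) c * N (.inr 0) d - N (.inr 0) c * N (.inl 0) d) * h
    - (M a (.inl 1) * M b (.inr 1) - M a (.inr 1) * M b (.inl 1)) * h'
    + (M a (.inl 1) * M b (.inr 1) - M a (.inr 1) * M b (.inl 1)) *
      (N (.inl 1) c * N (.inr 1) d - N (.inr 1) c * N (.inl 1) d) * h2

lemma bivMatrix_one : bivMatrix (1 : Matrix (Fin 2 ⊕ Fin 2) (Fin 2 ⊕ Fin 2) F) = 1 := by
  ext i j
  rcases i with i | i <;> rcases j with j | j <;> fin_cases i <;> fin_cases j <;>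
    simp [bivMatrix, bivFst, bivSnd, Matrix.one_apply]

/-- The form on bivectors is the wedge product into Λ⁴, so this is the Laplace expansion along two
pairs of rows. Isotropy of each pair removes the e₁∧f₁ and e₂∧f₂ terms modulo 2. -/
lemma form_bivMatrix [CharP F 2] {M : Matrix (Fin 2 ⊕ Fin 2) (Fin 2 ⊕ Fin 2) F}
    (hM : M ∈ Matrix.symplecticGroup (Fin 2) F) (i j : Fin 2 ⊕ Fin 2) :
    form (bivMatrix M i) (bivMatrix M j) =
      (M.submatrix ![bivFst i, bivSnd i, bivFst j, bivSnd j]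
        ![.inl 0, .inl 1, .inr 0, .inr 1]).det := by
  have h2 : (2 : F) = 0 := CharTwo.two_eq_zero
  have h := form_row_biv hM i
  have h' := form_row_biv hM j
  simp only [form] at h h'
  simp only [bivMatrix, form, Matrix.of_apply]
  generalize bivFst i = a at *
  generalize bivSnd i = b at *
  generalize bivFst j = c at *
  generalize bivSnd j = d at *
  simp only [bivFst, bivSnd, Sum.elim_inl, Sum.elim_inr, Matrix.cons_val_zero, Matrix.cons_val_one]
  rw [Matrix.det_succ_row_zero]
  simp only [Fin.sum_univ_four, Matrix.det_fin_three, Matrix.submatrix_apply, Fin.succAbove,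
    Matrix.cons_val]
  simp [Fin.lt_def]
  linear_combination (-(M c (.inl 1) * M d (.inr 1) - M c (.inr 1) * M d (.inl 1))) * h
    - (M a (.inl 1) * M b (.inr 1) - M a (.inr 1) * M b (.inl 1)) * h'
    + (-(M a (.inl 0) * M b (.inr 1) - M a (.inr 1) * M b (.inl 0)) *
        (M c (.inl 1) * M d (.inr 0) - M c (.inr 0) * M d (.inl 1))
      + (M a (.inl 0) * M b (.inr 0) - M a (.inr 0) * M b (.inl 0)) *
        (M c (.inl 1) * M d (.inr 1) - M c (.inr 1) * M d (.inl 1))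
      + (M a (.inl 1) * M b (.inr 1) - M a (.inr 1) * M b (.inl 1)) *
        (M c (.inl 0) * M d (.inr 0) - M c (.inr 0) * M d (.inl 0))
      + (M a (.inl 1) * M b (.inr 1) - M a (.inr 1) * M b (.inl 1)) *
        (M c (.inl 1) * M d (.inr 1) - M c (.inr 1) * M d (.inl 1))
      - (M a (.inr 0) * M b (.inr 1) - M a (.inr 1) * M b (.inr 0)) *
        (M c (.inl 0) * M d (.inl 1) - M c (.inl 1) * M d (.inl 0))) * h2

lemma bivMatrix_mem [CharP F 2] {M : Matrix (Fin 2 ⊕ Fin 2) (Fin 2 ⊕ Fin 2) F}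
    (hM : M ∈ Matrix.symplecticGroup (Fin 2) F) :
    bivMatrix M ∈ Matrix.symplecticGroup (Fin 2) F := by
  rw [mem_symplecticGroup_iff_form]
  intro i j
  rw [form_bivMatrix hM, ← bivMatrix_one, form_bivMatrix (one_mem _)]
  -- Selecting rows is left multiplication by selected rows of the identity, so det M = 1 reduces
  -- the claim to M = 1.
  have key : M.submatrix ![bivFst i, bivSnd i, bivFst j, bivSnd j]
        ![.inl 0, .inl 1, .inr 0, .inr 1] =
      (1 : Matrix (Fin 2 ⊕ Fin 2) (Fin 2 ⊕ Fin 2) F).submatrix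
        ![bivFst i, bivSnd i, bivFst j, bivSnd j] (finSumFinEquiv (m := 2) (n := 2)).symm *
      M.submatrix (finSumFinEquiv (m := 2) (n := 2)).symm
        (finSumFinEquiv (m := 2) (n := 2)).symm := by
    rw [Matrix.submatrix_mul_equiv, one_mul]
    congr 1
    ext k
    fin_cases k <;> rfl
  have e : (![.inl 0, .inl 1, .inr 0, .inr 1] : Fin 4 → Fin 2 ⊕ Fin 2) =
      (finSumFinEquiv (m := 2) (n := 2)).symm := by
    ext k
    fin_cases k <;> rfl
  rw [key, Matrix.det_mul, Matrix.det_submatrix_equiv_self, SymplecticGroup.det_eq_one hM, mul_one, e]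

/-- The Plücker relation gives p_ac p_bd = 0, and isotropy gives p_ac + p_bd = 0, so both vanish.
Then x∧y = e_a∧e_b, and x, y lie in the plane of e_a, e_b. -/
lemma offDiag_eq_zero_of_minors [CharP F 2] {x y : V4 F} {a b c d : Fin 2 ⊕ Fin 2}
    (hab : x a * y b - x b * y a = 1) (had : x a * y d - x d * y a = 0)
    (hcd : x c * y d - x d * y c = 0) (hcb : x c * y b - x b * y c = 0)
    (hf : x a * y c - x c * y a + (x b * y d - x d * y b) = 0) :
    x c = 0 ∧ x d = 0 ∧ y c = 0 ∧ y d = 0 := by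
  have h2 : (2 : F) = 0 := CharTwo.two_eq_zero
  have hac : x a * y c - x c * y a = 0 := by
    have : (x a * y c - x c * y a) ^ 2 = 0 := by
      grind
    exact pow_eq_zero_iff two_ne_zero |>.1 this
  have hbd : x b * y d - x d * y b = 0 := by grind
  refine ⟨?_, ?_, ?_, ?_⟩
  · linear_combination (-x c) * hab + x a * hcb + x b * hac
  · linear_combination (-x d) * hab - x a * hbd + x b * had
  · linear_combination (-y c) * hab + y a * hcb + y b * hac
  · linear_combination (-y d) * hab - y a * hbd + y b * had

lemma eq_one_of_bivMatrix_eq_one [CharP F 2] {M : Matrix (Fin 2 ⊕ Fin 2) (Fin 2 ⊕ Fin 2) F}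
    (hM : M ∈ Matrix.symplecticGroup (Fin 2) F) (h : bivMatrix M = 1) : M = 1 := by
  have h2 : (2 : F) = 0 := CharTwo.two_eq_zero
  have hij (i j) : M (bivFst i) (bivFst j) * M (bivSnd i) (bivSnd j) -
    M (bivFst i) (bivSnd j) * M (bivSnd i) (bivFst j) = (1 : Matrix _ _ F) i j := congr_fun₂ h i j
  have hf := form_row_biv hM
  have h₁ := offDiag_eq_zero_of_minors (x := M (.inl 0)) (y := M (.inl 1))
    (a := .inl 0) (b := .inl 1) (c := .inr 0) (d := .inr 1)
    (by simpa [bivFst, bivSnd] using hij (.inl 0) (.inl 0))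
    (by simpa [bivFst, bivSnd] using hij (.inl 0) (.inl 1))
    (by simpa [bivFst, bivSnd] using hij (.inl 0) (.inr 0))
    (by simpa [bivFst, bivSnd] using hij (.inl 0) (.inr 1))
    (by simpa [bivFst, bivSnd, form] using hf (.inl 0))
  have h₂ := offDiag_eq_zero_of_minors (x := M (.inl 0)) (y := M (.inr 1))
    (a := .inl 0) (b := .inr 1) (c := .inr 0) (d := .inl 1)
    (by simpa [bivFst, bivSnd] using hij (.inl 1) (.inl 1))
    (by simpa [bivFst, bivSnd] using hij (.inl 1) (.inl 0))
    (by simpa [bivFst, bivSnd] using hij (.inl 1) (.inr 1))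
    (by simpa [bivFst, bivSnd] using hij (.inl 1) (.inr 0))
    (by have := hf (.inl 1); simp [bivFst, bivSnd, form] at this; grind)
  have h₃ := offDiag_eq_zero_of_minors (x := M (.inr 0)) (y := M (.inr 1))
    (a := .inr 0) (b := .inr 1) (c := .inl 0) (d := .inl 1)
    (by simpa [bivFst, bivSnd] using hij (.inr 0) (.inr 0))
    (by simpa [bivFst, bivSnd] using hij (.inr 0) (.inr 1))
    (by simpa [bivFst, bivSnd] using hij (.inr 0) (.inl 0))
    (by simpa [bivFst, bivSnd] using hij (.inr 0) (.inl 1))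
    (by have := hf (.inr 0); simp [bivFst, bivSnd, form] at this; grind)
  have h₄ := offDiag_eq_zero_of_minors (x := M (.inr 0)) (y := M (.inl 1))
    (a := .inr 0) (b := .inl 1) (c := .inl 0) (d := .inr 1)
    (by simpa [bivFst, bivSnd] using hij (.inr 1) (.inr 1))
    (by simpa [bivFst, bivSnd] using hij (.inr 1) (.inr 0))
    (by simpa [bivFst, bivSnd] using hij (.inr 1) (.inl 1))
    (by simpa [bivFst, bivSnd] using hij (.inr 1) (.inl 0))
    (by have := hf (.inr 1); simp [bivFst, bivSnd, form] at this; grind)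
  have d₁ : M (.inl 0) (.inl 0) * M (.inl 1) (.inl 1) = 1 := by
    simpa [bivFst, bivSnd, h₂] using hij (.inl 0) (.inl 0)
  have d₂ : M (.inl 0) (.inl 0) * M (.inr 1) (.inr 1) = 1 := by
    simpa [bivFst, bivSnd, h₁] using hij (.inl 1) (.inl 1)
  have d₃ : M (.inr 0) (.inr 0) * M (.inr 1) (.inr 1) = 1 := by
    simpa [bivFst, bivSnd, h₄] using hij (.inr 0) (.inr 0)
  have d₄ : M (.inl 1) (.inl 1) * M (.inr 1) (.inr 1) = 1 := by
    have := mem_symplecticGroup_iff_form.1 hM (.inl 1) (.inr 1)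
    simpa [form, Matrix.one_apply, h₁, h₂, h₃, h₄] using this
  -- `d₁`, `d₂` and `d₄` make this entry a square root of 1, and 1 is the only one in characteristic
  -- 2.
  have e : M (.inl 1) (.inl 1) = 1 := by
    have : (M (.inl 1) (.inl 1) - 1) ^ 2 = 0 := by grind
    grind
  have e₁ : M (.inl 0) (.inl 0) = 1 := by simpa [e] using d₁
  have e₂ : M (.inr 1) (.inr 1) = 1 := by simpa [e] using d₄
  have e₃ : M (.inr 0) (.inr 0) = 1 := by simpa [e₂] using d₃
  ext i j
  rcases i with i | i <;> rcases j with j | j <;> fin_cases i <;> fin_cases j <;>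
    simp [e, e₁, e₂, e₃, h₁, h₂, h₃, h₄]

end GraphMap

/-! ### Eigenspaces and fixed points of symplectic maps -/

section FixedPoints

variable {F : Type*} [Field F]

/-- The linear map of `F⁴` given by a symplectic matrix. -/
noncomputable abbrev linMap (g : Sp4 F) : Module.End F (V4 F) :=
  Matrix.toLin' (g : Matrix (Fin 2 ⊕ Fin 2) (Fin 2 ⊕ Fin 2) F)

lemma linMap_mul (g h : Sp4 F) : linMap (g * h) = linMap g * linMap h :=
  Matrix.toLin'_mul _ _

lemma linMap_one : linMap (1 : Sp4 F) = 1 := Matrix.toLin'_one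

lemma linMap_injective : Function.Injective (linMap (F := F)) := fun _ _ h =>
  Subtype.ext (Matrix.toLin'.injective h)

lemma linMap_apply_injective (g : Sp4 F) : Function.Injective (linMap g) := by
  have h : linMap g⁻¹ * linMap g = 1 := by rw [← linMap_mul, inv_mul_cancel, linMap_one]
  exact Function.LeftInverse.injective (g := linMap g⁻¹) fun x => LinearMap.congr_fun h x

lemma proj_mk (g : Sp4 F) {v : V4 F} (hv : v ≠ 0) :
    proj F g (Projectivization.mk F v hv) =
      Projectivization.mk F (linMap g v)
        ((map_ne_zero_iff _ (linMap_apply_injective g)).2 hv) := rfl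

lemma proj_mk_eq_self_iff (g : Sp4 F) {v : V4 F} (hv : v ≠ 0) :
    proj F g (Projectivization.mk F v hv) = Projectivization.mk F v hv ↔
      ∃ c : F, v ∈ (linMap g).eigenspace c := by
  rw [proj_mk, Projectivization.mk_eq_mk_iff']
  simp only [Module.End.mem_eigenspace_iff, eq_comm]

lemma numFixed_eq_sum [Fintype F] (g : Sp4 F) :
    numFixed g = ∑ c : F, Nat.card (ℙ F ((linMap g).eigenspace c)) := by
  let incl (p : Σ c : F, ℙ F ((linMap g).eigenspace c)) : ℙ F (V4 F) :=
    Projectivization.map ((linMap g).eigenspace p.1).subtype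
      ((linMap g).eigenspace p.1).injective_subtype p.2
  have hinj : Function.Injective incl := by
    rintro ⟨c, x⟩ ⟨d, y⟩ h
    obtain rfl : c = d := by
      induction x using Projectivization.ind with | h v hv => ?_
      induction y using Projectivization.ind with | h w hw => ?_
      simp only [incl, Projectivization.map_mk, Projectivization.mk_eq_mk_iff'] at h
      obtain ⟨a, ha⟩ := h
      have h₁ := Module.End.mem_eigenspace_iff.1 v.2
      have h₂ := Module.End.mem_eigenspace_iff.1 w.2
      simp only [Submodule.subtype_apply] at ha
      have hv' : (v : V4 F) ≠ 0 := by simpa using hv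
      have : (c - d) • (v : V4 F) = 0 := by
        rw [sub_smul, ← h₁, ← ha, map_smul, h₂, smul_comm, sub_self]
      rcases smul_eq_zero.1 this with h | h
      · exact sub_eq_zero.1 h
      · exact absurd h hv'
    congr 1
    exact Projectivization.map_injective _ (Submodule.injective_subtype _) h
  have hrange : Set.range incl = {x | proj F g x = x} := by
    ext x
    induction x using Projectivization.ind with | h v hv => ?_
    rw [Set.mem_ofPred_eq, proj_mk_eq_self_iff]
    constructor
    · rintro ⟨⟨c, y⟩, h⟩
      induction y using Projectivization.ind with | h w hw => ?_
      simp only [incl, Projectivization.map_mk, Projectivization.mk_eq_mk_iff'] at h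
      obtain ⟨a, ha⟩ := h
      refine ⟨c, ?_⟩
      have hmem : a⁻¹ • (w : V4 F) ∈ (linMap g).eigenspace c := Submodule.smul_mem _ _ w.2
      have ha0 : a ≠ 0 := by
        rintro rfl
        apply hw
        simpa using ha.symm
      rw [Submodule.subtype_apply] at ha
      have : a⁻¹ • (w : V4 F) = v := by
        rw [← show a • v = (w : V4 F) from ha, smul_smul, inv_mul_cancel₀ ha0, one_smul]
      exact this ▸ hmem
    · rintro ⟨c, hc⟩
      exact ⟨⟨c, Projectivization.mk F ⟨v, hc⟩ (by simpa using hv)⟩, rfl⟩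
  rw [numFixed, ← hrange, ← Nat.card_sigma, ← Set.image_univ, Set.ncard_image_of_injective _ hinj,
    Set.ncard_univ]

lemma numFixed_eq_of_mul_self_eq_one [Finite F] [CharP F 2] {g : Sp4 F} (hg : g * g = 1) {d : ℕ}
    (hd : Module.finrank F ((linMap g).eigenspace 1) = d) :
    numFixed g = ∑ i ∈ Finset.range d, Nat.card F ^ i := by
  have := Fintype.ofFinite F
  rw [numFixed_eq_sum, ← Projectivization.card_of_finrank F _ hd]
  refine Finset.sum_eq_single _ (fun c _ hc => ?_) (by simp)
  have : (linMap g).eigenspace c = ⊥ := by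
    rw [Submodule.eq_bot_iff]
    intro v hv
    by_contra hv0
    rw [Module.End.mem_eigenspace_iff] at hv
    have h : linMap g (linMap g v) = v := by
      have := LinearMap.congr_fun (linMap_mul g g) v
      rw [hg, linMap_one] at this
      exact this.symm
    rw [hv, map_smul, hv, smul_smul] at h
    have h' : (c * c - 1) • v = 0 := by rw [sub_smul, h, one_smul, sub_self]
    rcases smul_eq_zero.1 h' with h | h
    · have h2 : (2 : F) = 0 := CharTwo.two_eq_zero
      have : (c - 1) ^ 2 = 0 := by linear_combination h + (1 - c) * h2
      exact hc (sub_eq_zero.1 (pow_eq_zero_iff two_ne_zero |>.1 this))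
    · exact hv0 h
  rw [this]
  exact Nat.card_of_isEmpty

/-- The invariant alternating form as a bilinear form. -/
def bilinForm : LinearMap.BilinForm F (V4 F) :=
  LinearMap.mk₂ F form (by intros; simp [form]; ring) (by intros; simp [form]; ring)
    (by intros; simp [form]; ring) (by intros; simp [form]; ring)

lemma bilinForm_apply (x y : V4 F) : bilinForm x y = form x y := rfl

lemma form_self (x : V4 F) : form x x = 0 := by simp [form]; ring

lemma form_comm [CharP F 2] (x y : V4 F) : form x y = form y x := by
  have h2 : (2 : F) = 0 := CharTwo.two_eq_zero
  simp only [form]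
  linear_combination (x (.inl 0) * y (.inr 0) - x (.inr 0) * y (.inl 0) +
    (x (.inl 1) * y (.inr 1) - x (.inr 1) * y (.inl 1))) * h2

lemma eq_zero_of_form_eq_zero {y : V4 F} (h : ∀ x, form x y = 0) : y = 0 := by
  ext i
  rcases i with i | i <;> fin_cases i
  · simpa [form] using h (Pi.single (.inr 0) 1)
  · simpa [form] using h (Pi.single (.inr 1) 1)
  · simpa [form] using h (Pi.single (.inl 0) 1)
  · simpa [form] using h (Pi.single (.inl 1) 1)

lemma form_linMap (g : Sp4 F) (x y : V4 F) : form (linMap g x) (linMap g y) = form x y := by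
  have hform (x y : V4 F) : form x y = - (x ⬝ᵥ (Matrix.J (Fin 2) F).mulVec y) := by
    simp [form, dotProduct, Matrix.mulVec, Matrix.J, Fintype.sum_sum_type, Fin.sum_univ_two,
      Matrix.fromBlocks, Matrix.one_apply]
    ring
  have h := SymplecticGroup.mem_iff'.1 g.2
  rw [hform, hform, Matrix.toLin'_apply, Matrix.toLin'_apply, Matrix.mulVec_mulVec,
    ← Matrix.vecMul_transpose, ← Matrix.dotProduct_mulVec, Matrix.mulVec_mulVec,
    ← Matrix.mul_assoc, h]

lemma finrank_le_two_of_isotropic [CharP F 2] {W : Submodule F (V4 F)}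
    (h : ∀ x ∈ W, ∀ y ∈ W, form x y = 0) : Module.finrank F W ≤ 2 := by
  have hB : (bilinForm (F := F)).IsRefl := fun x y hxy => by
    rw [bilinForm_apply, form_comm]; exact hxy
  have hnd : (bilinForm (F := F)).Nondegenerate := by
    refine ⟨fun x hx => eq_zero_of_form_eq_zero fun y => ?_, fun y hy => eq_zero_of_form_eq_zero hy⟩
    rw [form_comm]; exact hx y
  have h₁ := LinearMap.BilinForm.finrank_orthogonal hnd W
  have h₂ : W ≤ (bilinForm (F := F)).orthogonal W := fun x hx y hy => h y hy x hx
  have h₃ := Submodule.finrank_mono h₂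
  simp at h₁
  omega

lemma isTransvection_of_three_le_finrank [CharP F 2] {g : Sp4 F} (hg : g ≠ 1) {c : F}
    (hc : 3 ≤ Module.finrank F ((linMap g).eigenspace c)) : IsTransvection g := by
  have h2 : (2 : F) = 0 := CharTwo.two_eq_zero
  obtain ⟨x, hx, y, hy, hxy⟩ : ∃ x ∈ (linMap g).eigenspace c, ∃ y ∈ (linMap g).eigenspace c,
      form x y ≠ 0 := by
    by_contra! h
    have := finrank_le_two_of_isotropic h
    omega
  obtain rfl : c = 1 := by
    rw [Module.End.mem_eigenspace_iff] at hx hy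
    have h := form_linMap g x y
    rw [hx, hy, ← bilinForm_apply, ← bilinForm_apply, map_smul, map_smul, LinearMap.smul_apply,
      smul_eq_mul, smul_eq_mul, bilinForm_apply] at h
    have h' : c * c = 1 := by
      apply mul_right_cancel₀ hxy
      linear_combination h
    have : (c - 1) ^ 2 = 0 := by linear_combination h' + (1 - c) * h2
    exact sub_eq_zero.1 (pow_eq_zero_iff two_ne_zero |>.1 this)
  have hN : linMap g - 1 ≠ 0 := fun h =>
    hg (linMap_injective (by rw [linMap_one]; exact sub_eq_zero.1 h))
  obtain ⟨x₀, hx₀⟩ : ∃ x, (linMap g - 1) x ≠ 0 := by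
    by_contra! h
    exact hN (LinearMap.ext h)
  obtain ⟨i, hi⟩ := Function.ne_iff.1 hx₀
  set v := (linMap g - 1) x₀ with hv
  have hker : (linMap g).eigenspace 1 = LinearMap.ker (linMap g - 1) := by
    rw [Module.End.eigenspace_def, one_smul]
  have hrank : Module.finrank F (LinearMap.range (linMap g - 1)) ≤ 1 := by
    have := LinearMap.finrank_range_add_finrank_ker (linMap g - 1)
    rw [hker] at hc
    simp at this
    omega
  have hline (x : V4 F) : ∃ a : F, a • v = (linMap g - 1) x := by
    obtain ⟨⟨w, hw⟩, hspan⟩ := finrank_le_one_iff.1 hrank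
    obtain ⟨a, ha⟩ := hspan ⟨_, LinearMap.mem_range_self _ x⟩
    obtain ⟨b, hb⟩ := hspan ⟨_, LinearMap.mem_range_self _ x₀⟩
    simp only [Subtype.ext_iff, SetLike.val_smul] at ha hb
    have hb0 : b ≠ 0 := by
      rintro rfl
      exact hx₀ (by rw [hv, ← hb, zero_smul])
    exact ⟨a * b⁻¹, by rw [hv, ← hb, ← ha, smul_smul, inv_mul_cancel_right₀ hb0]⟩
  let f : Module.Dual F (V4 F) := (v i)⁻¹ • (LinearMap.proj i ∘ₗ (linMap g - 1))
  have hf (x : V4 F) : linMap g x = x + f x • v := by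
    obtain ⟨a, ha⟩ := hline x
    have hfx : f x = a := by
      simp only [f, LinearMap.smul_apply, LinearMap.comp_apply, ← ha, LinearMap.proj_apply,
        Pi.smul_apply, smul_eq_mul]
      rw [mul_comm a, inv_mul_cancel_left₀ hi]
    rw [hfx, ha]
    simp
  refine ⟨hg, f, v, ?_, LinearMap.ext fun x => by rw [hf x, LinearMap.transvection.apply]⟩
  -- Invariance reads (1 + f v)·form x v = form x v, so f v ≠ 0 would put v in the radical.
  by_contra hfv
  apply hx₀
  refine eq_zero_of_form_eq_zero fun x => ?_
  have h := form_linMap g x v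
  rw [hf, hf] at h
  simp only [← bilinForm_apply, map_add, map_smul, LinearMap.add_apply, LinearMap.smul_apply,
    smul_eq_mul] at h
  simp only [bilinForm_apply, form_self] at h
  have : f v * form x v = 0 := by linear_combination h
  exact (mul_eq_zero.1 this).resolve_left hfv

lemma IsTransvection.mul_self [CharP F 2] {g : Sp4 F} (hg : IsTransvection g) : g * g = 1 := by
  obtain ⟨-, f, v, hfv, h⟩ := hg
  change linMap g = _ at h
  apply linMap_injective
  rw [linMap_mul, linMap_one]
  refine LinearMap.ext fun x => ?_
  change linMap g (linMap g x) = x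
  rw [h]
  simp [LinearMap.transvection.apply, hfv, add_assoc, ← two_smul F, CharTwo.two_eq_zero]

lemma IsTransvection.numFixed_eq [Finite F] [CharP F 2] {g : Sp4 F} (hg : IsTransvection g) :
    numFixed g = Nat.card F ^ 2 + Nat.card F + 1 := by
  have hsq := hg.mul_self
  obtain ⟨h1, f, v, hfv, h⟩ := hg
  change linMap g = _ at h
  have hf : f ≠ 0 := by
    rintro rfl
    apply h1
    apply linMap_injective
    rw [linMap_one]
    refine LinearMap.ext fun x => ?_
    rw [h]
    simp
  have hv : v ≠ 0 := by
    rintro rfl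
    apply h1
    apply linMap_injective
    rw [linMap_one]
    refine LinearMap.ext fun x => ?_
    rw [h]
    simp
  have hE : (linMap g).eigenspace 1 = LinearMap.ker f := by
    ext x
    rw [Module.End.mem_eigenspace_iff, h, LinearMap.transvection.apply, LinearMap.mem_ker]
    simp [hv]
  have hd : Module.finrank F ((linMap g).eigenspace 1) = 3 := by
    have := Module.Dual.finrank_ker_add_one_of_ne_zero hf
    rw [hE]
    simp at this
    omega
  rw [numFixed_eq_of_mul_self_eq_one hsq hd, Finset.sum_range_succ, Finset.sum_range_succ,
    Finset.sum_range_one]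
  ring

lemma finrank_eigenspace_le_two [CharP F 2] {g : Sp4 F} (h1 : g ≠ 1) (hg : ¬ IsTransvection g)
    (c : F) : Module.finrank F ((linMap g).eigenspace c) ≤ 2 := by
  by_contra! h
  exact hg (isTransvection_of_three_le_finrank h1 h)

lemma numFixed_eq_of_involution [Finite F] [CharP F 2] {g : Sp4 F} (h1 : g ≠ 1)
    (hg : ¬ IsTransvection g) (hsq : g * g = 1) : numFixed g = Nat.card F + 1 := by
  have hle := finrank_eigenspace_le_two h1 hg 1
  have hge : 2 ≤ Module.finrank F ((linMap g).eigenspace 1) := by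
    have hker : (linMap g).eigenspace 1 = LinearMap.ker (linMap g - 1) := by
      rw [Module.End.eigenspace_def, one_smul]
    have h := LinearMap.finrank_range_add_finrank_ker (linMap g - 1)
    have h0 : (linMap g - 1) * (linMap g - 1) = 0 := by
      have : linMap g * linMap g = 1 := by rw [← linMap_mul, hsq, linMap_one]
      rw [sub_mul, mul_sub, this, mul_one, one_mul]
      refine LinearMap.ext fun x => ?_
      have h2 : (2 : F) = 0 := CharTwo.two_eq_zero
      simp only [LinearMap.sub_apply, Module.End.one_apply, LinearMap.zero_apply]
      ext i
      simp only [Pi.sub_apply, Pi.zero_apply]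
      linear_combination (x i - linMap g x i) * h2
    have hr : LinearMap.range (linMap g - 1) ≤ LinearMap.ker (linMap g - 1) :=
      LinearMap.range_le_ker_iff.2 h0
    have := Submodule.finrank_mono hr
    rw [hker]
    simp at h
    omega
  rw [numFixed_eq_of_mul_self_eq_one hsq (le_antisymm hle hge), Finset.sum_range_succ,
    Finset.sum_range_one]
  ring

lemma sum_finrank_eigenspace_le [Fintype F] {V : Type*} [AddCommGroup V] [Module F V]
    [Module.Finite F V] (f : Module.End F V) :
    ∑ c : F, Module.finrank F (f.eigenspace c) ≤ Module.finrank F V := by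
  classical
  calc ∑ c : F, Module.finrank F (f.eigenspace c)
      ≤ ∑ c : F, f.charpoly.roots.count c := Finset.sum_le_sum fun c _ => by
        rw [Polynomial.count_roots]; exact LinearMap.finrank_eigenspace_le f c
    _ = f.charpoly.roots.card := Multiset.sum_count_eq_card (by simp)
    _ ≤ f.charpoly.natDegree := Polynomial.card_roots' _
    _ = Module.finrank F V := LinearMap.charpoly_natDegree f

lemma numFixed_le [Finite F] [CharP F 2] {g : Sp4 F} (h1 : g ≠ 1) (hg : ¬ IsTransvection g) :
    numFixed g ≤ 2 * Nat.card F + 2 := by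
  have := Fintype.ofFinite F
  have hq : 1 ≤ Nat.card F := Nat.card_pos
  -- Each eigenspace has dimension at most 2, so it contributes at most (q+1)/2 points per
  -- dimension; the dimensions sum to at most 4.
  have hterm (c : F) : 2 * Nat.card (ℙ F ((linMap g).eigenspace c)) ≤
      Module.finrank F ((linMap g).eigenspace c) * (Nat.card F + 1) := by
    have h := finrank_eigenspace_le_two h1 hg c
    rw [Projectivization.card_of_finrank F _ rfl]
    interval_cases Module.finrank F ((linMap g).eigenspace c)
    · simp
    · rw [Finset.sum_range_one, pow_zero]; omega
    · rw [Finset.sum_range_succ, Finset.sum_range_one, pow_zero, pow_one]; omega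
  have hsum := sum_finrank_eigenspace_le (linMap g)
  have : 2 * numFixed g ≤ 4 * (Nat.card F + 1) := by
    rw [numFixed_eq_sum, Finset.mul_sum]
    refine (Finset.sum_le_sum fun c _ => hterm c).trans ?_
    rw [← Finset.sum_mul]
    refine Nat.mul_le_mul_right _ (hsum.trans ?_)
    simp
  omega

lemma numFixed_le_of_card_eq_two [Finite F] [CharP F 2] (hF : Nat.card F = 2) {g : Sp4 F}
    (h1 : g ≠ 1) (hg : ¬ IsTransvection g) : numFixed g ≤ 3 := by
  have := Fintype.ofFinite F
  -- Over the field of two elements 1 is the only possible eigenvalue, so a single eigenspace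
  -- counts.
  have h0 : ∀ c : F, c ≠ 1 → c = 0 := by
    intro c hc
    have h := FiniteField.pow_card c
    rw [← Nat.card_eq_fintype_card, hF] at h
    have : c * (c - 1) = 0 := by linear_combination h
    exact (mul_eq_zero.1 this).resolve_right (sub_ne_zero.2 hc)
  rw [numFixed_eq_sum, Finset.sum_eq_single 1, Projectivization.card_of_finrank F _ rfl]
  · refine (Finset.sum_le_sum_of_subset (Finset.range_mono
      (finrank_eigenspace_le_two h1 hg 1))).trans ?_
    rw [Finset.sum_range_succ, Finset.sum_range_one, hF, pow_zero, pow_one]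
  · intro c _ hc
    obtain rfl := h0 c hc
    have : (linMap g).eigenspace 0 = ⊥ := by
      rw [Module.End.eigenspace_zero, LinearMap.ker_eq_bot]
      exact linMap_apply_injective g
    rw [this]
    exact Nat.card_of_isEmpty
  · simp

lemma numFixed_conj (h g : Sp4 F) : numFixed (h * g * h⁻¹) = numFixed g := by
  have : {x | proj F (h * g * h⁻¹) x = x} = proj F h '' {x | proj F g x = x} := by
    ext x
    constructor
    · intro hx
      refine ⟨(proj F h)⁻¹ x, ?_, by simp⟩
      have hx' : proj F h (proj F g ((proj F h)⁻¹ x)) = x := by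
        simpa only [map_mul, map_inv, Equiv.Perm.mul_apply, Set.mem_ofPred_eq] using hx
      exact (Equiv.Perm.eq_inv_iff_eq.2 hx')
    · rintro ⟨y, hy, rfl⟩
      simpa [map_mul, Equiv.Perm.mul_apply] using hy
  rw [numFixed, this, Set.ncard_image_of_injective _ (proj F h).injective, numFixed]

variable (F) in
lemma exists_isTransvection : ∃ g : Sp4 F, IsTransvection g := by
  let B : Matrix (Fin 2) (Fin 2) F := Matrix.diagonal ![1, 0]
  have hmem : Matrix.fromBlocks 1 B 0 1 ∈ Matrix.symplecticGroup (Fin 2) F := by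
    rw [SymplecticGroup.fromBlocks_mem_iff]
    simp [B]
  refine ⟨⟨_, hmem⟩, fun h => ?_, LinearMap.proj (.inr 0), Pi.single (.inl 0) 1, by simp, ?_⟩
  · have := congr_fun₂ (congr_arg Subtype.val h) (.inl 0) (.inr 0)
    simp [B] at this
  · refine LinearMap.ext fun x => funext fun i => ?_
    rw [LinearMap.transvection.apply, Matrix.toLin'_apply]
    rcases i with i | i <;> fin_cases i <;>
      simp [B, Matrix.mulVec, dotProduct, Fintype.sum_sum_type, Matrix.one_apply]

lemma card_projectivization [Finite F] [Fintype (ℙ F (V4 F))] : Fintype.card (ℙ F (V4 F)) =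
    Nat.card F ^ 3 + Nat.card F ^ 2 + Nat.card F + 1 := by
  rw [← Nat.card_eq_fintype_card, Projectivization.card_of_finrank F (V4 F) (n := 4) (by simp)]
  simp only [Finset.sum_range_succ, Finset.sum_range_zero]
  ring

end FixedPoints

/-! ### The graph automorphism as a twist -/

section GraphAutomorphism

variable {F : Type*} [Field F] [CharP F 2]

/-- The endomorphism of `Sp(4, F)` in characteristic two given by the exceptional isogeny. -/
def bivHom : Sp4 F →* Sp4 F where
  toFun g := ⟨bivMatrix g, bivMatrix_mem g.2⟩
  map_one' := Subtype.ext bivMatrix_one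
  map_mul' g h := Subtype.ext (bivMatrix_mul g.2 h.2)

lemma bivHom_injective : Function.Injective (bivHom (F := F)) :=
  (injective_iff_map_eq_one _).2 fun g hg =>
    Subtype.ext (eq_one_of_bivMatrix_eq_one g.2 (congr_arg Subtype.val hg))

/-- The graph automorphism of `Sp(4, F)` for a finite field `F` of characteristic two. -/
noncomputable def graphAut [Finite F] : MulAut (Sp4 F) :=
  MulEquiv.ofBijective bivHom (Finite.injective_iff_bijective.1 bivHom_injective)

/-- Invariance of the form makes f proportional to form(·, v); pairing with v swaps the e and f
coordinates. -/
lemma IsTransvection.exists_entries {g : Sp4 F} (hg : IsTransvection g) :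
    ∃ (a : F) (v : V4 F), a ≠ 0 ∧ v ≠ 0 ∧ ∀ i j,
      (g : Matrix (Fin 2 ⊕ Fin 2) (Fin 2 ⊕ Fin 2) F) i j =
        (1 : Matrix (Fin 2 ⊕ Fin 2) (Fin 2 ⊕ Fin 2) F) i j + a * v i * v j.swap := by
  obtain ⟨h1, f, v, hfv, h⟩ := hg
  change linMap g = _ at h
  have hv : v ≠ 0 := by
    rintro rfl
    apply h1
    apply linMap_injective
    rw [linMap_one]
    refine LinearMap.ext fun x => ?_
    rw [h]
    simp
  obtain ⟨x, hx⟩ : ∃ x, form x v ≠ 0 := by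
    by_contra! h
    exact hv (eq_zero_of_form_eq_zero h)
  have hf (y : V4 F) : f y = f x / form x v * form y v := by
    have h' := form_linMap g x y
    rw [h, LinearMap.transvection.apply, LinearMap.transvection.apply] at h'
    simp only [← bilinForm_apply, map_add, map_smul, LinearMap.add_apply, LinearMap.smul_apply,
      smul_eq_mul] at h'
    simp only [bilinForm_apply, form_self, form_comm v y] at h'
    have h2 : (2 : F) = 0 := CharTwo.two_eq_zero
    field_simp
    linear_combination h' - f x * form y v * h2
  have hij (i j) : (g : Matrix (Fin 2 ⊕ Fin 2) (Fin 2 ⊕ Fin 2) F) i j =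
        (1 : Matrix (Fin 2 ⊕ Fin 2) (Fin 2 ⊕ Fin 2) F) i j +
          f x / form x v * v i * v j.swap := by
    have h' := congr_fun (LinearMap.congr_fun h (Pi.single j 1)) i
    have hj : form (Pi.single j 1) v = v j.swap := by
      rcases j with j | j <;> fin_cases j <;> simp [form, CharTwo.neg_eq]
    rw [LinearMap.transvection.apply, hf, hj, Matrix.toLin'_apply, Matrix.mulVec_single_one] at h'
    rw [Matrix.col_apply] at h'
    rw [h', Pi.add_apply, Pi.smul_apply, smul_eq_mul, Matrix.one_apply, Pi.single_apply]
    ring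
  refine ⟨_, v, fun ha => ?_, hv, hij⟩
  apply h1
  ext i j
  rw [hij, ha]
  simp

lemma IsTransvection.minor_eq {g : Sp4 F} (hg : IsTransvection g) (i j k l : Fin 2 ⊕ Fin 2) :
    let N := (g : Matrix (Fin 2 ⊕ Fin 2) (Fin 2 ⊕ Fin 2) F) - 1
    N i k * N j l = N i l * N j k := by
  obtain ⟨a, v, -, -, h⟩ := hg.exists_entries
  simp only [Matrix.sub_apply, h]
  ring

lemma not_isTransvection_bivHom {g : Sp4 F} (hg : IsTransvection g) :
    ¬ IsTransvection (bivHom g) := by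
  intro hb
  obtain ⟨a, v, ha, hv, h⟩ := hg.exists_entries
  have hm := hb.minor_eq
  have h2 : (2 : F) = 0 := CharTwo.two_eq_zero
  simp only [Matrix.sub_apply, bivHom, MonoidHom.coe_mk, OneHom.coe_mk, bivMatrix,
    Matrix.of_apply, h] at hm
  -- For a transvection, g − 1 has rank one. The 2 × 2 minor of `bivMatrix g` − 1 chosen for each
  -- coordinate equals ±a²v_i⁴, so its vanishing would force v = 0.
  have key : ∀ i, a ^ 2 * v i ^ 4 = 0 := by
    intro i
    rcases i with i | i <;> fin_cases i
    · have := hm (.inl 0) (.inl 1) (.inr 0) (.inr 1)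
      simp [bivFst, bivSnd, Matrix.one_apply] at this ⊢
      grind
    · have := hm (.inl 0) (.inr 1) (.inl 1) (.inr 0)
      simp [bivFst, bivSnd, Matrix.one_apply] at this ⊢
      grind
    · have := hm (.inr 0) (.inr 1) (.inl 0) (.inl 1)
      simp [bivFst, bivSnd, Matrix.one_apply] at this ⊢
      grind
    · have := hm (.inr 0) (.inl 1) (.inl 0) (.inr 1)
      simp [bivFst, bivSnd, Matrix.one_apply] at this ⊢
      grind
  apply hv
  ext i
  have := key i
  simpa [ha] using this

/-- Conjugation preserves the number of fixed points, while q²+q+1 ≠ q+1. -/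
lemma isTwist_of_numFixed [Finite F] {τ : MulAut (Sp4 F)}
    (h : ∀ g : Sp4 F, IsTransvection g → numFixed (τ g) = Nat.card F + 1) : IsTwist τ := by
  refine ⟨?_, h⟩
  rintro ⟨x, rfl⟩
  obtain ⟨t, ht⟩ := exists_isTransvection F
  have h₁ := h t ht
  rw [MulAut.conj_apply, numFixed_conj, ht.numFixed_eq] at h₁
  have : 0 < Nat.card F ^ 2 := pow_pos Nat.card_pos 2
  omega

lemma isTwist_graphAut [Finite F] : IsTwist (graphAut (F := F)) := by
  refine isTwist_of_numFixed fun g hg => ?_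
  change numFixed (bivHom g) = _
  refine numFixed_eq_of_involution ?_ (not_isTransvection_bivHom hg) ?_
  · rw [Ne, map_eq_one_iff _ bivHom_injective]
    exact hg.1
  · rw [← map_mul, hg.mul_self, map_one]

end GraphAutomorphism

/-! ### Distance of a twisted code from fixed points -/

section CodeDistance

variable {T Ω : Type*} [Group T] [Fintype Ω] [DecidableEq Ω] {r : ℕ}

lemma hammingDist_codeword_add (I : Fin r → (T →* Equiv.Perm Ω)) (s t : T) :
    hammingDist (codeword I s) (codeword I t) + ∑ i, {x | I i (s⁻¹ * t) x = x}.ncard =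
      r * Fintype.card Ω := by
  have hfix (i : Fin r) : {x | I i (s⁻¹ * t) x = x}.ncard =
      (Finset.univ.filter fun x => I i s x = I i t x).card := by
    rw [← Set.ncard_coe_finset]
    congr 1
    ext x
    simp only [map_mul, map_inv, Equiv.Perm.mul_apply, Set.mem_ofPred_eq, Finset.coe_filter,
      Finset.mem_univ, true_and]
    rw [Equiv.Perm.inv_eq_iff_eq]
    exact eq_comm
  have hsum : ∑ i, {x | I i (s⁻¹ * t) x = x}.ncard =
      (Finset.univ.filter fun p => codeword I s p = codeword I t p).card := by
    simp_rw [hfix, Finset.card_filter]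
    rw [Fintype.sum_prod_type]
    rfl
  rw [hsum, hammingDist, add_comm, Finset.card_filter_add_card_filter_not]
  simp

lemma minDist_twistedCode {I : Fin r → (T →* Equiv.Perm Ω)} {K d : ℕ} (hd : 0 < d)
    (hK : d + K = r * Fintype.card Ω)
    (hle : ∀ t : T, t ≠ 1 → ∑ i, {x | I i t x = x}.ncard ≤ K)
    (hex : ∃ t : T, ∑ i, {x | I i t x = x}.ncard = K) :
    minDist (twistedCode I) = d := by
  refine IsLeast.csInf_eq ⟨?_, ?_⟩
  · obtain ⟨t, ht⟩ := hex
    have h := hammingDist_codeword_add I 1 t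
    rw [inv_one, one_mul, ht] at h
    have hdist : hammingDist (codeword I 1) (codeword I t) = d := by omega
    refine ⟨_, ⟨1, rfl⟩, _, ⟨t, rfl⟩, ?_, hdist⟩
    rw [← hammingDist_pos, hdist]
    exact hd
  · rintro _ ⟨_, ⟨s, rfl⟩, _, ⟨t, rfl⟩, hne, rfl⟩
    have h := hammingDist_codeword_add I s t
    have := hle (s⁻¹ * t) fun h1 => hne (by rw [inv_mul_eq_one.1 h1])
    omega

end CodeDistance

/-! ### The extremal counts and the minimum distances -/

section Main

variable {F : Type*} [Field F] [Finite F] [CharP F 2]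

lemma numFixed_le_of_ne_one {g : Sp4 F} (h1 : g ≠ 1) :
    numFixed g ≤ Nat.card F ^ 2 + Nat.card F + 1 := by
  by_cases hg : IsTransvection g
  · exact hg.numFixed_eq.le
  · have := numFixed_le h1 hg
    have hq : 1 < Nat.card F := Finite.one_lt_card
    nlinarith

lemma IsTwist.numFixed_add_le {τ : MulAut (Sp4 F)} (hτ : IsTwist τ) {t : Sp4 F} (h1 : t ≠ 1) :
    numFixed t + numFixed (τ t) ≤ Nat.card F ^ 2 + 2 * Nat.card F + 2 := by
  by_cases ht : IsTransvection t
  · rw [ht.numFixed_eq, hτ.2 t ht]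
    omega
  have h1' : τ t ≠ 1 := (map_ne_one_iff τ τ.injective).2 h1
  by_cases ht' : IsTransvection (τ t)
  · have hsq : t * t = 1 := τ.injective (by rw [map_mul, ht'.mul_self, map_one])
    rw [ht'.numFixed_eq, numFixed_eq_of_involution h1 ht hsq]
    omega
  -- The bound 2(2q+2) ≤ q²+2q+2 holds for q ≥ 3 but fails for q = 2, where the sharper bound 3 is
  -- needed.
  · rcases lt_or_ge (Nat.card F) 3 with hq | hq
    · have hq' : Nat.card F = 2 := by
        have : 1 < Nat.card F := Finite.one_lt_card
        omega
      have := numFixed_le_of_card_eq_two hq' h1 ht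
      have := numFixed_le_of_card_eq_two hq' h1' ht'
      rw [hq']
      omega
    · have := numFixed_le h1 ht
      have := numFixed_le h1' ht'
      nlinarith

variable [Fintype (ℙ F (V4 F))] [DecidableEq (ℙ F (V4 F))]

lemma IsTwist.minDist_eq {τ : MulAut (Sp4 F)} (hτ : IsTwist τ) :
    minDist (twistedCode (pairRep τ)) = 2 * Nat.card F ^ 3 + Nat.card F ^ 2 := by
  have hsum (t : Sp4 F) : ∑ i, {x | pairRep τ i t x = x}.ncard = numFixed t + numFixed (τ t) := by
    rw [Fin.sum_univ_two]
    rfl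
  have hq : 0 < Nat.card F := Nat.card_pos
  refine minDist_twistedCode (K := Nat.card F ^ 2 + 2 * Nat.card F + 2) (by positivity) ?_ ?_ ?_
  · rw [card_projectivization]
    ring
  · intro t ht
    rw [hsum]
    exact hτ.numFixed_add_le ht
  · obtain ⟨t, ht⟩ := exists_isTransvection F
    refine ⟨t, ?_⟩
    rw [hsum, ht.numFixed_eq, hτ.2 t ht]
    ring

lemma minDist_repCode (σ : MulAut (Sp4 F)) :
    minDist (repCode 2 ((proj F).comp σ.toMonoidHom)) = 2 * Nat.card F ^ 3 := by
  have hsum (t : Sp4 F) : ∑ _i : Fin 2, {x | (proj F).comp σ.toMonoidHom t x = x}.ncard =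
      2 * numFixed (σ t) := by
    rw [Fin.sum_univ_two, ← two_mul]
    rfl
  have hq : 0 < Nat.card F := Nat.card_pos
  refine minDist_twistedCode (K := 2 * (Nat.card F ^ 2 + Nat.card F + 1)) (by positivity) ?_ ?_ ?_
  · rw [card_projectivization]
    ring
  · intro t ht
    rw [hsum]
    exact Nat.mul_le_mul_left 2 (numFixed_le_of_ne_one ((map_ne_one_iff σ σ.injective).2 ht))
  · obtain ⟨t, ht⟩ := exists_isTransvection F
    -- As σ permutes the nonidentity elements, the maximum is that of the natural action, reached at
    -- the preimage of a transvection.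
    refine ⟨σ.symm t, ?_⟩
    rw [hsum, MulEquiv.apply_symm_apply, ht.numFixed_eq]

lemma repBound_pairRep (τ : MulAut (Sp4 F)) : repBound (pairRep τ) = 2 * Nat.card F ^ 3 := by
  have h (i : Fin 2) : minDist (repCode 2 (pairRep τ i)) = 2 * Nat.card F ^ 3 := by
    fin_cases i
    · exact minDist_repCode 1
    · exact minDist_repCode τ
  rw [repBound, funext h]
  exact ciInf_const

end Main

end TwistedPermCode

theorem proposition4p6 (n q : ℕ) (hn : 1 ≤ n) (hq : q = 2 ^ n)
    (F : Type*) [Field F] (hF : Nat.card F = q)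
    [Fintype (ℙ F (TwistedPermCode.V4 F))] [DecidableEq (ℙ F (TwistedPermCode.V4 F))] :
    (∃ τ : MulAut (TwistedPermCode.Sp4 F), TwistedPermCode.IsTwist τ) ∧
    Fintype.card (Fin 2 × ℙ F (TwistedPermCode.V4 F)) = 2 * (q ^ 3 + q ^ 2 + q + 1) ∧
    ∀ τ : MulAut (TwistedPermCode.Sp4 F), TwistedPermCode.IsTwist τ →
      TwistedPermCode.minDist (TwistedPermCode.twistedCode (TwistedPermCode.pairRep τ)) =
        2 * q ^ 3 + q ^ 2 ∧
      TwistedPermCode.repBound (TwistedPermCode.pairRep τ) = 2 * q ^ 3 ∧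
      TwistedPermCode.minDist (TwistedPermCode.twistedCode (TwistedPermCode.pairRep τ)) =
        TwistedPermCode.repBound (TwistedPermCode.pairRep τ) + q ^ 2 := by
  have : Finite F := Nat.finite_of_card_ne_zero (by rw [hF, hq]; positivity)
  have : CharP F 2 := by
    have := Fintype.ofFinite F
    obtain ⟨p, hp⟩ := CharP.exists F
    obtain ⟨m, hprime, hm⟩ := FiniteField.card F p
    rw [← Nat.card_eq_fintype_card, hF, hq] at hm
    have hdvd : p ∣ 2 ^ n := hm ▸ dvd_pow_self p m.ne_zero
    rwa [(Nat.prime_dvd_prime_iff_eq hprime Nat.prime_two).1 (hprime.dvd_of_dvd_pow hdvd)] at hp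
  subst hF
  refine ⟨⟨_, TwistedPermCode.isTwist_graphAut⟩, ?_, fun τ hτ => ?_⟩
  · rw [Fintype.card_prod, Fintype.card_fin, TwistedPermCode.card_projectivization]
  · rw [hτ.minDist_eq, TwistedPermCode.repBound_pairRep]
    exact ⟨rfl, rfl, rfl⟩
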